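/- **The language ECPS.** Types are $A ::= \neg(A_1,\dots,A_n)\mid \mathtt{nat}\mid\mathtt{unit}$ ($n\ge 0$). Fix a set $\Sigma$ of effect operations. Values and computations are $$v,w ::= \mathtt{zero}\mid\mathtt{succ}(v)\mid\star\mid\lambda(\vec x){:}(\vec A).\,t\mid x,\qquad t,u ::= v(\vec w)\mid(\mu x.v)(\vec w)\mid\sigma(v,x.t)\mid{\downarrow}\mid\mathtt{case}\ v\ \mathtt{in}\ \{\mathtt{zero}\Rightarrow t,\ \mathtt{succ}(x)\Rightarrow u\}$$ with $\sigma\in\Sigma$, and only well-typed terms are considered: $\lambda(\vec x){:}(\vec A).t$ has type $\neg(\vec A)$ if $t$ is a computation in the context extended by $\vec x:\vec A$; $v(\vec w)$ requires $v:\neg(\vec A)$ and $\vec w:\vec A$; $(\mu x.v)(\vec w)$ requires $v:\neg(\vec A)$ in the context extended by $x:\neg(\vec A)$, and $\vec w:\vec A$; $\sigma(v,x.t)$ requires $v:\mathtt{nat}$ and $x:\mathtt{nat}$ in $t$; $\mathtt{case}$ requires $v:\mathtt{nat}$ and $x:\mathtt{nat}$ in $u$; the remaining rules are the obvious ones. Computations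 have no type. Write $\overline n=\mathtt{succ}^n(\mathtt{zero})$. Closed computations reduce by $$(\lambda(\vec x){:}(\vec A).t)(\vec w)\to t[\vec w/\vec x],\qquad (\mu x.v)(\vec w)\to \bigl(v[\lambda(\vec y){:}(\vec A).(\mu x.v)(\vec y)/x]\bigr)(\vec w),$$ and the usual two rules for $\mathtt{case}$. **Trees and observations.** Effect trees are possibly infinite trees with leaves $\bot$ and $\downarrow$ and with inner nodes $\sigma_n$ ($\sigma\in\Sigma$, $n\in\mathbb N$), which have one child for each natural number. They form an $\omega$-cpo under: $tr_1\le tr_2$ iff $tr_1$ is obtained from $tr_2$ by replacing subtrees by $\bot$. The tree $|t|=\bigsqcup_n|t|_n$ of a closed computation $t$ is given by $|t|_0=\bot$; $|t|_{n+1}=|s|_n$ if $t\to s$; $|\sigma(\overline m,x.s)|_{n+1}=\sigma_m(|s[\overline 0/x]|_n,|s[\overline 1/x]|_n,\dots)$; $|{\downarrow}|_{n+1}={\downarrow}$. Let $\mathfrak P$ be a set of sets of effect trees. A set $X$ of trees is *Scott-open* if it is upwards closed and, whenever the supremum of an ascending $\omega$-chain lies in $X$, so does some element of the chain. $\mathfrak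 P$ is *decomposable* if for all $P\in\mathfrak P$ and all $\sigma_n(tr_0,tr_1,\dots)\in P$ there are $P_0,P_1,\dots\in\mathfrak P$ with $tr_k\in P_k$ for all $k$ such that $\sigma_n(p_0,p_1,\dots)\in P$ whenever $p_k\in P_k$ for all $k$. **Logics.** In both logics $\mathcal F$ and $\mathcal V$ the computation formulas are the $P\in\mathfrak P$, with $t\models P$ iff $|t|\in P$. The typed value formulas are generated by $\{n\}:\mathtt{nat}$ for $n\in\mathbb N$, by conjunctions $\bigwedge_{i\in I}\phi_i:A$ and disjunctions $\bigvee_{i\in I}\phi_i:A$ of arbitrary set-indexed families $\phi_i:A$, by negations $\neg\phi:A$ of $\phi:A$, and by basic formulas of type $\neg(A_1,\dots,A_n)$ for $P\in\mathfrak P$: these are $(\phi_1,\dots,\phi_n)\mapsto P$ with formulas $\phi_i:A_i$ in $\mathcal F$, and $(w_1,\dots,w_n)\mapsto P$ with closed values $w_i:A_i$ in $\mathcal V$. For closed values $v$ of the type of the formula: $v\models\{n\}$ iff $v=\overline n$; in $\mathcal F$, $v\models(\vec\phi)\mapsto P$ iff $|v(\vec w)|\in P$ for all closed values $w_i:A_i$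 with $w_i\models\phi_i$ for every $i$; in $\mathcal V$, $v\models(\vec w)\mapsto P$ iff $|v(\vec w)|\in P$; the connectives have their usual meaning. $\mathcal F^+$ and $\mathcal V^+$ are the fragments without negation. **Translations.** Let $(\mathcal L,\mathcal M)$ be $(\mathcal F,\mathcal V)$ or $(\mathcal F^+,\mathcal V^+)$. For closed values $v,u:A$ write $v\sqsubseteq_{\mathcal L}u$ if $u$ satisfies every formula $\phi:A$ of $\mathcal L$ that $v$ satisfies, and let $\chi_v$ be the characteristic formula of $v$ in $\mathcal L$: the conjunction, over all closed values $u:A$ with $v\not\sqsubseteq_{\mathcal L}u$, of a chosen formula of $\mathcal L$ that holds of $v$ but not of $u$ (so $u\models\chi_v$ iff $v\sqsubseteq_{\mathcal L}u$). Define $(-)^\flat$ from $\mathcal L$ to $\mathcal M$ and $(-)^\sharp$ from $\mathcal M$ to $\mathcal L$ by $$((\phi_1,\dots,\phi_n)\mapsto P)^\flat=\bigwedge\{(w_1,\dots,w_n)\mapsto P\mid w_i\models\phi_i^\flat\text{ for all }i\},\qquad ((w_1,\dots,w_n)\mapsto P)^\sharp=(\chi_{w_1},\dots,\chi_{w_n})\mapsto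 P,$$ where the $w_i$ on the left range over the closed values of type $A_i$; both translations fix all $\{n\}$ and all $P\in\mathfrak P$ and commute with $\bigvee$, $\bigwedge$ and $\neg$. **Theorem.** Let $\mathfrak P$ be a decomposable set of Scott-open sets of effect trees. Then the logics $\mathcal F$ and $\mathcal V$ are equi-expressive, and so are $\mathcal F^+$ and $\mathcal V^+$. That is, for $(\mathcal L,\mathcal M)$ either of these two pairs: 1. for every type $A$, every formula $\phi:A$ of $\mathcal L$ and every closed value $v:A$, $v\models_{\mathcal L}\phi\iff v\models_{\mathcal M}\phi^\flat$; and for every $P\in\mathfrak P$ and every closed computation $t$, $t\models_{\mathcal L}P\iff t\models_{\mathcal M}P^\flat$; 2. for every type $A$, every formula $\phi:A$ of $\mathcal M$ and every closed value $v:A$, $v\models_{\mathcal M}\phi\iff v\models_{\mathcal L}\phi^\sharp$; and for every $P\in\mathfrak P$ and every closed computation $t$, $t\models_{\mathcal M}P\iff t\models_{\mathcal L}P^\sharp$. -/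

import Mathlib

universe u

namespace ECPS

open OmegaCompletePartialOrder

/-! ## Types and contexts -/

/-- Types `A ::= ¬(A₁,…,Aₙ) | nat | unit`, with `n ∈ ℕ`. -/
inductive Ty : Type
  | neg {n : ℕ} (A : Fin n → Ty) : Ty
  | nat : Ty
  | unit : Ty

/-- Contexts. `Γ.ext A` is `Γ, x₁:A₁, …, xₙ:Aₙ`, the variables bound together by one binder. -/
inductive Ctx : Type
  | nil : Ctx
  | ext (Γ : Ctx) {n : ℕ} (A : Fin n → Ty) : Ctx

/-- `Γ, x:A`. -/
abbrev Ctx.snoc (Γ : Ctx) (A : Ty) : Ctx := Γ.ext (fun _ : Fin 1 => A)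

/-- `Var Γ A`: the variables of type `A` declared in `Γ`. -/
inductive Var : Ctx → Ty → Type
  | here {Γ : Ctx} {n : ℕ} {A : Fin n → Ty} (i : Fin n) : Var (Γ.ext A) (A i)
  | there {Γ : Ctx} {n : ℕ} {A : Fin n → Ty} {B : Ty} (x : Var Γ B) : Var (Γ.ext A) B

/-! ## Values and computations -/

/- `Val S Γ A` is the set of values `v` with `Γ ⊢ v : A` and `Comp S Γ` is the set of computations
`t` with `Γ ⊢ t`, up to renaming of bound variables, over the signature `S` of effect operations.
Only well-typed terms are built: each constructor is one typing rule. -/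
mutual
inductive Val (S : Type u) : Ctx → Ty → Type u
  | var {Γ : Ctx} {A : Ty} (x : Var Γ A) : Val S Γ A
  | zero {Γ : Ctx} : Val S Γ Ty.nat
  | succ {Γ : Ctx} (v : Val S Γ Ty.nat) : Val S Γ Ty.nat
  | star {Γ : Ctx} : Val S Γ Ty.unit
  | lam {Γ : Ctx} {n : ℕ} {A : Fin n → Ty} (t : Comp S (Γ.ext A)) : Val S Γ (Ty.neg A)
inductive Comp (S : Type u) : Ctx → Type u
  /-- `v (w₁,…,wₙ)` -/
  | app {Γ : Ctx} {n : ℕ} {A : Fin n → Ty}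
      (v : Val S Γ (Ty.neg A)) (w : ∀ i, Val S Γ (A i)) : Comp S Γ
  /-- `(μ x. v) (w₁,…,wₙ)` -/
  | mu {Γ : Ctx} {n : ℕ} {A : Fin n → Ty}
      (v : Val S (Γ.snoc (Ty.neg A)) (Ty.neg A)) (w : ∀ i, Val S Γ (A i)) : Comp S Γ
  /-- `σ(v, x. t)` -/
  | op {Γ : Ctx} (σ : S) (v : Val S Γ Ty.nat) (t : Comp S (Γ.snoc Ty.nat)) : Comp S Γ
  /-- `↓` -/
  | halt {Γ : Ctx} : Comp S Γ
  /-- `case v in {zero ⇒ s, succ(x) ⇒ t}` -/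
  | caseNat {Γ : Ctx} (v : Val S Γ Ty.nat) (s : Comp S Γ) (t : Comp S (Γ.snoc Ty.nat)) : Comp S Γ
end

/-- Closed values of type `A`. -/
abbrev CVal (S : Type u) (A : Ty) : Type u := Val S Ctx.nil A

/-- Closed computations. -/
abbrev CComp (S : Type u) : Type u := Comp S Ctx.nil

/-- The numeral `succⁿ(zero)`. -/
def numeral {S : Type u} {Γ : Ctx} : ℕ → Val S Γ Ty.nat
  | 0 => Val.zero
  | n + 1 => Val.succ (numeral n)

/-! ## Substitution -/

/-- Renamings of variables. -/
abbrev Ren (Γ Δ : Ctx) : Type := ∀ A : Ty, Var Γ A → Var Δ A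

/-- A renaming extended to newly bound variables, which it fixes. -/
def Ren.lift {Γ Δ : Ctx} {n : ℕ} {A : Fin n → Ty} (ρ : Ren Γ Δ) : Ren (Γ.ext A) (Δ.ext A)
  | _, Var.here i => Var.here i
  | _, Var.there x => Var.there (ρ _ x)

mutual
def Val.rename {S : Type u} {Γ Δ : Ctx} {A : Ty} (ρ : Ren Γ Δ) : Val S Γ A → Val S Δ A
  | .var x => .var (ρ _ x)
  | .zero => .zero
  | .succ v => .succ (v.rename ρ)
  | .star => .star
  | .lam t => .lam (t.rename ρ.lift)
def Comp.rename {S : Type u} {Γ Δ : Ctx} (ρ : Ren Γ Δ) : Comp S Γ → Comp S Δ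
  | .app v w => .app (v.rename ρ) (fun i => (w i).rename ρ)
  | .mu v w => .mu (v.rename ρ.lift) (fun i => (w i).rename ρ)
  | .op σ v t => .op σ (v.rename ρ) (t.rename ρ.lift)
  | .halt => .halt
  | .caseNat v s t => .caseNat (v.rename ρ) (s.rename ρ) (t.rename ρ.lift)
end

/-- Simultaneous substitutions of values for variables. -/
abbrev Subst (S : Type u) (Γ Δ : Ctx) : Type u := ∀ A : Ty, Var Γ A → Val S Δ A

/-- A substitution extended to newly bound variables, which it fixes. -/
def Subst.lift {S : Type u} {Γ Δ : Ctx} {n : ℕ} {A : Fin n → Ty} (θ : Subst S Γ Δ) :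
    Subst S (Γ.ext A) (Δ.ext A)
  | _, Var.here i => Val.var (Var.here i)
  | _, Var.there x => (θ _ x).rename (fun _ => Var.there)

mutual
def Val.subst {S : Type u} {Γ Δ : Ctx} {A : Ty} (θ : Subst S Γ Δ) : Val S Γ A → Val S Δ A
  | .var x => θ _ x
  | .zero => .zero
  | .succ v => .succ (v.subst θ)
  | .star => .star
  | .lam t => .lam (t.subst θ.lift)
def Comp.subst {S : Type u} {Γ Δ : Ctx} (θ : Subst S Γ Δ) : Comp S Γ → Comp S Δ
  | .app v w => .app (v.subst θ) (fun i => (w i).subst θ)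
  | .mu v w => .mu (v.subst θ.lift) (fun i => (w i).subst θ)
  | .op σ v t => .op σ (v.subst θ) (t.subst θ.lift)
  | .halt => .halt
  | .caseNat v s t => .caseNat (v.subst θ) (s.subst θ) (t.subst θ.lift)
end

/-- The substitution `[w₁/x₁, …, wₙ/xₙ]` of values for the last bound variables. -/
def Subst.inst {S : Type u} {Γ : Ctx} {n : ℕ} {A : Fin n → Ty} (w : ∀ i, Val S Γ (A i)) :
    Subst S (Γ.ext A) Γ
  | _, Var.here i => w i
  | _, Var.there x => Val.var x

/-- The substitution `[w/x]` for a single variable. -/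
def Subst.inst₁ {S : Type u} {Γ : Ctx} {A : Ty} (w : Val S Γ A) : Subst S (Γ.snoc A) Γ :=
  Subst.inst (A := fun _ : Fin 1 => A) (fun _ => w)

/-! ## Operational semantics -/

/-- The number denoted by a closed value of type `nat`. -/
def Val.toNat {S : Type u} : CVal S Ty.nat → ℕ
  | .zero => 0
  | .succ v => v.toNat + 1

/-- What a closed computation does next: it reduces (`t ⟶ s`), it performs an effect with a
parameter and a continuation for each natural number, or it has stopped. -/
inductive NextAction (S : Type u) : Type u
  | reduce (s : CComp S) : NextAction S
  | effect (σ : S) (m : ℕ) (k : ℕ → CComp S) : NextAction S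
  | stopped : NextAction S

/-- `λ(y₁,…,yₙ). (μ x. v)(y₁,…,yₙ)` -/
def Val.unroll {S : Type u} {Γ : Ctx} {n : ℕ} {A : Fin n → Ty}
    (v : Val S (Γ.snoc (Ty.neg A)) (Ty.neg A)) : Val S Γ (Ty.neg A) :=
  .lam (.mu (v.rename (Ren.lift (fun _ => Var.there))) (fun i => .var (Var.here i)))

/-- The reduction relations, which are deterministic, as a function. Every closed computation
has exactly one next action. -/
def Comp.next {S : Type u} : CComp S → NextAction S
  | .app (.lam t) w => .reduce (t.subst (Subst.inst w))
  | .mu v w => .reduce (.app (v.subst (Subst.inst₁ v.unroll)) w)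
  | .op σ v t => .effect σ v.toNat (fun k => t.subst (Subst.inst₁ (numeral k)))
  | .halt => .stopped
  | .caseNat .zero s _ => .reduce s
  | .caseNat (.succ v) _ t => .reduce (t.subst (Subst.inst₁ v))

/-! ## Effect trees -/

/-- Node labels of effect trees: the leaves `⊥` and `↓`, and inner nodes `σₙ`. -/
inductive Label (S : Type u) : Type u
  | bot : Label S
  | halt : Label S
  | op (σ : S) (n : ℕ) : Label S

/-- Effect trees, of possibly infinite depth. A node is addressed by the list of child indices that
leads to it from the root; a node labelled `σₙ` has one child for each natural number. Addresses
that are not in the tree (those below a leaf) carry the label `⊥`. -/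
@[ext]
structure EffTree (S : Type u) : Type u where
  label : List ℕ → Label S
  leaf : ∀ (p : List ℕ) (k : ℕ), (∀ σ n, label p ≠ Label.op σ n) → label (p ++ [k]) = Label.bot

namespace EffTree

variable {S : Type u}

/-- The leaf `⊥`. -/
def bot : EffTree S := ⟨fun _ => Label.bot, fun _ _ _ => rfl⟩

/-- The leaf `↓`. -/
def halt : EffTree S :=
  ⟨fun p => match p with
    | [] => Label.halt
    | _ :: _ => Label.bot,
   fun p _ _ => by cases p <;> rfl⟩

/-- The tree `σₙ(ts₀, ts₁, …)`. -/
def node (σ : S) (n : ℕ) (ts : ℕ → EffTree S) : EffTree S :=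
  ⟨fun p => match p with
    | [] => Label.op σ n
    | k :: q => (ts k).label q,
   fun p k h => by
    cases p with
    | nil => exact absurd rfl (h σ n)
    | cons j q => exact (ts j).leaf q k h⟩

/-- `tr₁ ≤ tr₂` if `tr₁` arises from `tr₂` by replacing subtrees by `⊥`. -/
instance : PartialOrder (EffTree S) where
  le a b := ∀ p, a.label p = Label.bot ∨ a.label p = b.label p
  le_refl _ _ := Or.inr rfl
  le_trans a b c hab hbc p := by
    rcases hab p with h | h
    · exact Or.inl h
    · rw [h]; exact hbc p
  le_antisymm a b hab hba := by
    ext1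
    funext p
    rcases hab p with h | h
    · rcases hba p with h' | h'
      · rw [h, h']
      · exact h'.symm
    · exact h

theorem le_def {a b : EffTree S} :
    a ≤ b ↔ ∀ p, a.label p = Label.bot ∨ a.label p = b.label p := Iff.rfl

open Classical in
/-- Labels of the least upper bound of a chain: at each address, the label other than `⊥` that is
reached along the chain, if there is one. -/
noncomputable def supLabel (c : Chain (EffTree S)) (p : List ℕ) : Label S :=
  if h : ∃ n, (c n).label p ≠ Label.bot then (c h.choose).label p else Label.bot

theorem supLabel_eq (c : Chain (EffTree S)) (p : List ℕ) (n : ℕ)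
    (hn : (c n).label p ≠ Label.bot) : supLabel c p = (c n).label p := by
  have h : ∃ n, (c n).label p ≠ Label.bot := ⟨n, hn⟩
  rw [supLabel, dif_pos h]
  rcases le_total h.choose n with hle | hle
  · exact ((c.monotone hle) p).resolve_left h.choose_spec
  · exact (((c.monotone hle) p).resolve_left hn).symm

theorem supLabel_cases (c : Chain (EffTree S)) (p : List ℕ) :
    (supLabel c p = Label.bot ∧ ∀ n, (c n).label p = Label.bot) ∨
      ∃ n, (c n).label p ≠ Label.bot ∧ supLabel c p = (c n).label p := by
  by_cases h : ∃ n, (c n).label p ≠ Label.bot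
  · obtain ⟨n, hn⟩ := h
    exact Or.inr ⟨n, hn, supLabel_eq c p n hn⟩
  · refine Or.inl ⟨by rw [supLabel, dif_neg h], ?_⟩
    push Not at h
    exact h

/-- Effect trees form an `ω`-cpo. -/
noncomputable instance : OmegaCompletePartialOrder (EffTree S) where
  ωSup c :=
    ⟨supLabel c, fun p k h => by
      rcases supLabel_cases c (p ++ [k]) with h' | ⟨n, hn, -⟩
      · exact h'.1
      · refine absurd ((c n).leaf p k fun σ m hm => ?_) hn
        exact h σ m ((supLabel_eq c p n (by rw [hm]; simp)).trans hm)⟩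
  le_ωSup c n p := by
    by_cases h : (c n).label p = Label.bot
    · exact Or.inl h
    · exact Or.inr (supLabel_eq c p n h).symm
  ωSup_le c x hx p := by
    rcases supLabel_cases c p with h | ⟨n, hn, h⟩
    · exact Or.inl h.1
    · exact Or.inr (h.trans ((hx n p).resolve_left hn))

theorem bot_le (a : EffTree S) : bot ≤ a := fun _ => Or.inl rfl

theorem node_mono (σ : S) (n : ℕ) {ts us : ℕ → EffTree S} (h : ∀ k, ts k ≤ us k) :
    node σ n ts ≤ node σ n us := by
  intro p
  cases p with
  | nil => exact Or.inr rfl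
  | cons k q => exact h k q

end EffTree

/-- The approximation `|t|ₙ` of the tree of a closed computation. -/
def approx {S : Type u} : ℕ → CComp S → EffTree S
  | 0, _ => EffTree.bot
  | n + 1, t => match t.next with
    | .reduce s => approx n s
    | .effect σ m k => EffTree.node σ m (fun i => approx n (k i))
    | .stopped => EffTree.halt

theorem approx_le_succ {S : Type u} (n : ℕ) (t : CComp S) : approx n t ≤ approx (n + 1) t := by
  induction n generalizing t with
  | zero => exact EffTree.bot_le _
  | succ n ih =>
    rw [approx, approx]
    cases t.next with
    | reduce s => exact ih s
    | effect σ m k => exact EffTree.node_mono σ m (fun i => ih (k i))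
    | stopped => exact le_refl _

/-- The computation tree `|t| = ⨆ₙ |t|ₙ` of a closed computation. -/
noncomputable def tree {S : Type u} (t : CComp S) : EffTree S :=
  ωSup ⟨fun n => approx n t, monotone_nat_of_le_succ fun n => approx_le_succ n t⟩

/-! ## Observations -/

/-- Scott-open sets of trees. -/
def ScottOpen {S : Type u} (X : Set (EffTree S)) : Prop :=
  IsUpperSet X ∧ ∀ c : Chain (EffTree S), ωSup c ∈ X → ∃ j, c j ∈ X

/-- Decomposable sets of observations. -/
def Decomposable {S : Type u} (𝔓 : Set (Set (EffTree S))) : Prop :=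
  ∀ P ∈ 𝔓, ∀ tr ∈ P, ∀ (σ : S) (n : ℕ) (ts : ℕ → EffTree S), tr = EffTree.node σ n ts →
    ∃ Q : ℕ → Set (EffTree S), (∀ k, Q k ∈ 𝔓) ∧ (∀ k, ts k ∈ Q k) ∧
      ∀ us : ℕ → EffTree S, (∀ k, us k ∈ Q k) → EffTree.node σ n us ∈ P

/-! ## The two logics -/

/-- The fragment of a logic: with negation (`𝓕`, `𝓥`) or without negation (`𝓕⁺`, `𝓥⁺`). -/
inductive Fragment : Type
  | full : Fragment
  | positive : Fragment

/-- Value formulas of the logic `𝓕` (of `𝓕⁺` if `L` is `positive`) of a given type. -/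
inductive FFormula {S : Type u} (𝔓 : Set (Set (EffTree S))) (L : Fragment) : Ty → Type (u + 1)
  /-- `{n} : nat` -/
  | nat (n : ℕ) : FFormula 𝔓 L Ty.nat
  /-- `(φ₁,…,φₙ) ↦ P : ¬(A₁,…,Aₙ)` -/
  | arrow {n : ℕ} {A : Fin n → Ty} (φ : ∀ i, FFormula 𝔓 L (A i)) (P : 𝔓) : FFormula 𝔓 L (Ty.neg A)
  | disj {A : Ty} {I : Type u} (φ : I → FFormula 𝔓 L A) : FFormula 𝔓 L A
  | conj {A : Ty} {I : Type u} (φ : I → FFormula 𝔓 L A) : FFormula 𝔓 L A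
  | neg {A : Ty} (h : L = Fragment.full) (φ : FFormula 𝔓 L A) : FFormula 𝔓 L A

/-- Value formulas of the logic `𝓥` (of `𝓥⁺` if `L` is `positive`) of a given type. -/
inductive VFormula {S : Type u} (𝔓 : Set (Set (EffTree S))) (L : Fragment) : Ty → Type (u + 1)
  /-- `{n} : nat` -/
  | nat (n : ℕ) : VFormula 𝔓 L Ty.nat
  /-- `(w₁,…,wₙ) ↦ P : ¬(A₁,…,Aₙ)` -/
  | arrow {n : ℕ} {A : Fin n → Ty} (w : ∀ i, CVal S (A i)) (P : 𝔓) : VFormula 𝔓 L (Ty.neg A)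
  | disj {A : Ty} {I : Type u} (φ : I → VFormula 𝔓 L A) : VFormula 𝔓 L A
  | conj {A : Ty} {I : Type u} (φ : I → VFormula 𝔓 L A) : VFormula 𝔓 L A
  | neg {A : Ty} (h : L = Fragment.full) (φ : VFormula 𝔓 L A) : VFormula 𝔓 L A

variable {S : Type u} {𝔓 : Set (Set (EffTree S))} {L : Fragment}

/-- Satisfaction `v ⊨ φ` for value formulas of `𝓕` and `𝓕⁺`. -/
def FFormula.Sat : {A : Ty} → FFormula 𝔓 L A → CVal S A → Prop
  | _, .nat n, v => v = numeral n
  | _, .arrow φ P, v => ∀ w, (∀ i, (φ i).Sat (w i)) → tree (.app v w) ∈ P.1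
  | _, .disj φ, v => ∃ j, (φ j).Sat v
  | _, .conj φ, v => ∀ j, (φ j).Sat v
  | _, .neg _ φ, v => ¬ φ.Sat v

/-- Satisfaction `v ⊨ φ` for value formulas of `𝓥` and `𝓥⁺`. -/
def VFormula.Sat : {A : Ty} → VFormula 𝔓 L A → CVal S A → Prop
  | _, .nat n, v => v = numeral n
  | _, .arrow w P, v => tree (.app v w) ∈ P.1
  | _, .disj φ, v => ∃ j, (φ j).Sat v
  | _, .conj φ, v => ∀ j, (φ j).Sat v
  | _, .neg _ φ, v => ¬ φ.Sat v

/-- The computation formulas of all four logics are the observations `P ∈ 𝔓`. -/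
abbrev CompFormula (𝔓 : Set (Set (EffTree S))) : Type u := 𝔓

/-- Satisfaction `t ⊨ P` for computation formulas, the same in all four logics. -/
def CompFormula.Sat (P : CompFormula 𝔓) (t : CComp S) : Prop := tree t ∈ P.1

/-! ## Translations -/

/-- The logical preorder `v ⊑ u` on closed values of type `A` induced by `𝓕` or `𝓕⁺`. -/
def FPreorder (𝔓 : Set (Set (EffTree S))) (L : Fragment) {A : Ty} (v u : CVal S A) : Prop :=
  ∀ φ : FFormula 𝔓 L A, φ.Sat v → φ.Sat u

theorem exists_distinguishing {A : Ty} {v u : CVal S A} (h : ¬ FPreorder 𝔓 L v u) :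
    ∃ φ : FFormula 𝔓 L A, φ.Sat v ∧ ¬ φ.Sat u := by
  unfold FPreorder at h
  push Not at h
  exact h

/-- The characteristic formula `χ_v` in `𝓕` or `𝓕⁺`: the conjunction, over all closed values `u`
with `v ⋢ u`, of a chosen formula that holds of `v` but not of `u`. -/
noncomputable def charFormula (𝔓 : Set (Set (EffTree S))) (L : Fragment) {A : Ty} (v : CVal S A) :
    FFormula 𝔓 L A :=
  .conj (I := {u : CVal S A // ¬ FPreorder 𝔓 L v u}) fun u => (exists_distinguishing u.2).choose

theorem sat_charFormula {A : Ty} (v u : CVal S A) :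
    (charFormula 𝔓 L v).Sat u ↔ FPreorder 𝔓 L v u := by
  constructor
  · intro h
    by_contra hvu
    exact (exists_distinguishing hvu).choose_spec.2 (h ⟨u, hvu⟩)
  · intro h j
    exact h _ (exists_distinguishing j.2).choose_spec.1

/-- The translation `φ ↦ φ^♭` from `𝓕` to `𝓥`, and from `𝓕⁺` to `𝓥⁺`. -/
def FFormula.flat : {A : Ty} → FFormula 𝔓 L A → VFormula 𝔓 L A
  | _, .nat n => .nat n
  | _, .arrow (A := A) φ P =>
      .conj (I := {w : ∀ i, CVal S (A i) // ∀ i, (φ i).flat.Sat (w i)}) fun w => .arrow w.1 P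
  | _, .disj φ => .disj fun i => (φ i).flat
  | _, .conj φ => .conj fun i => (φ i).flat
  | _, .neg h φ => .neg h φ.flat

/-- The translation `φ ↦ φ^♯` from `𝓥` to `𝓕`, and from `𝓥⁺` to `𝓕⁺`. -/
noncomputable def VFormula.sharp : {A : Ty} → VFormula 𝔓 L A → FFormula 𝔓 L A
  | _, .nat n => .nat n
  | _, .arrow w P => .arrow (fun i => charFormula 𝔓 L (w i)) P
  | _, .disj φ => .disj fun i => (φ i).sharp
  | _, .conj φ => .conj fun i => (φ i).sharp
  | _, .neg h φ => .neg h φ.sharp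

/-- `P^♭ = P` on computation formulas. -/
def CompFormula.flat (P : CompFormula 𝔓) : CompFormula 𝔓 := P

/-- `P^♯ = P` on computation formulas. -/
def CompFormula.sharp (P : CompFormula 𝔓) : CompFormula 𝔓 := P

end ECPS

open ECPS

namespace ECPS

open OmegaCompletePartialOrder

/-! ## Substitution lemmas -/

theorem Ren.lift_comp {Γ Δ Θ : Ctx} {n : ℕ} {A : Fin n → Ty} (ρ : Ren Γ Δ) (τ : Ren Δ Θ) :
    (fun B x => (τ.lift (A := A)) B (ρ.lift B x)) = Ren.lift (A := A) (fun B x => τ B (ρ B x)) := by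
  funext B x
  cases x <;> rfl

theorem Subst.lift_comp_ren {S : Type u} {Γ Δ Θ : Ctx} {n : ℕ} {A : Fin n → Ty} (ρ : Ren Γ Δ)
    (θ : Subst S Δ Θ) :
    (fun B x => (θ.lift (A := A)) B (ρ.lift B x)) =
      Subst.lift (A := A) (fun B x => θ B (ρ B x)) := by
  funext B x
  cases x <;> rfl

mutual
theorem Val.rename_rename {S : Type u} {Γ Δ Θ : Ctx} {A : Ty} (ρ : Ren Γ Δ) (τ : Ren Δ Θ) :
    (v : Val S Γ A) → (v.rename ρ).rename τ = v.rename (fun B x => τ B (ρ B x))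
  | .var x => by simp [Val.rename]
  | .zero => by simp [Val.rename]
  | .succ v => by simp [Val.rename, Val.rename_rename ρ τ v]
  | .star => by simp [Val.rename]
  | .lam t => by simp [Val.rename, Comp.rename_rename _ _ t, Ren.lift_comp]
theorem Comp.rename_rename {S : Type u} {Γ Δ Θ : Ctx} (ρ : Ren Γ Δ) (τ : Ren Δ Θ) :
    (t : Comp S Γ) → (t.rename ρ).rename τ = t.rename (fun B x => τ B (ρ B x))
  | .app v w => by
    simp [Comp.rename, Val.rename_rename _ _ v, fun i => Val.rename_rename ρ τ (w i)]
  | .mu v w => by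
    simp [Comp.rename, Val.rename_rename _ _ v, fun i => Val.rename_rename ρ τ (w i),
      Ren.lift_comp]
  | .op σ v t => by
    simp [Comp.rename, Val.rename_rename _ _ v, Comp.rename_rename _ _ t, Ren.lift_comp]
  | .halt => by simp [Comp.rename]
  | .caseNat v s t => by
    simp [Comp.rename, Val.rename_rename _ _ v, Comp.rename_rename _ _ s,
      Comp.rename_rename _ _ t, Ren.lift_comp]
end

mutual
theorem Val.rename_subst {S : Type u} {Γ Δ Θ : Ctx} {A : Ty} (ρ : Ren Γ Δ) (θ : Subst S Δ Θ) :
    (v : Val S Γ A) → (v.rename ρ).subst θ = v.subst (fun B x => θ B (ρ B x))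
  | .var x => by simp [Val.rename, Val.subst]
  | .zero => by simp [Val.rename, Val.subst]
  | .succ v => by simp [Val.rename, Val.subst, Val.rename_subst _ _ v]
  | .star => by simp [Val.rename, Val.subst]
  | .lam t => by
    simp [Val.rename, Val.subst, Comp.rename_subst _ _ t, Subst.lift_comp_ren]
theorem Comp.rename_subst {S : Type u} {Γ Δ Θ : Ctx} (ρ : Ren Γ Δ) (θ : Subst S Δ Θ) :
    (t : Comp S Γ) → (t.rename ρ).subst θ = t.subst (fun B x => θ B (ρ B x))
  | .app v w => by
    simp [Comp.rename, Comp.subst, Val.rename_subst _ _ v, fun i => Val.rename_subst ρ θ (w i)]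
  | .mu v w => by
    simp [Comp.rename, Comp.subst, Val.rename_subst _ _ v, fun i => Val.rename_subst ρ θ (w i),
      Subst.lift_comp_ren]
  | .op σ v t => by
    simp [Comp.rename, Comp.subst, Val.rename_subst _ _ v, Comp.rename_subst _ _ t,
      Subst.lift_comp_ren]
  | .halt => by simp [Comp.rename, Comp.subst]
  | .caseNat v s t => by
    simp [Comp.rename, Comp.subst, Val.rename_subst _ _ v, Comp.rename_subst _ _ s,
      Comp.rename_subst _ _ t, Subst.lift_comp_ren]
end

theorem Subst.lift_rename {S : Type u} {Γ Δ Θ : Ctx} {n : ℕ} {A : Fin n → Ty} (θ : Subst S Γ Δ)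
    (ρ : Ren Δ Θ) :
    (fun B x => ((θ.lift (A := A)) B x).rename ρ.lift) =
      Subst.lift (A := A) (fun B x => (θ B x).rename ρ) := by
  funext B x
  cases x with
  | here i => rfl
  | there x => simp only [Subst.lift, Val.rename_rename]; rfl

mutual
theorem Val.subst_rename {S : Type u} {Γ Δ Θ : Ctx} {A : Ty} (θ : Subst S Γ Δ) (ρ : Ren Δ Θ) :
    (v : Val S Γ A) → (v.subst θ).rename ρ = v.subst (fun B x => (θ B x).rename ρ)
  | .var x => by simp [Val.subst]
  | .zero => by simp [Val.rename, Val.subst]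
  | .succ v => by simp [Val.rename, Val.subst, Val.subst_rename _ _ v]
  | .star => by simp [Val.rename, Val.subst]
  | .lam t => by
    simp [Val.rename, Val.subst, Comp.subst_rename _ _ t, Subst.lift_rename]
theorem Comp.subst_rename {S : Type u} {Γ Δ Θ : Ctx} (θ : Subst S Γ Δ) (ρ : Ren Δ Θ) :
    (t : Comp S Γ) → (t.subst θ).rename ρ = t.subst (fun B x => (θ B x).rename ρ)
  | .app v w => by
    simp [Comp.rename, Comp.subst, Val.subst_rename _ _ v, fun i => Val.subst_rename θ ρ (w i)]
  | .mu v w => by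
    simp [Comp.rename, Comp.subst, Val.subst_rename _ _ v, fun i => Val.subst_rename θ ρ (w i),
      Subst.lift_rename]
  | .op σ v t => by
    simp [Comp.rename, Comp.subst, Val.subst_rename _ _ v, Comp.subst_rename _ _ t,
      Subst.lift_rename]
  | .halt => by simp [Comp.rename, Comp.subst]
  | .caseNat v s t => by
    simp [Comp.rename, Comp.subst, Val.subst_rename _ _ v, Comp.subst_rename _ _ s,
      Comp.subst_rename _ _ t, Subst.lift_rename]
end

theorem Subst.lift_subst {S : Type u} {Γ Δ Θ : Ctx} {n : ℕ} {A : Fin n → Ty} (θ : Subst S Γ Δ)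
    (η : Subst S Δ Θ) :
    (fun B x => ((θ.lift (A := A)) B x).subst η.lift) =
      Subst.lift (A := A) (fun B x => (θ B x).subst η) := by
  funext B x
  cases x with
  | here i => rfl
  | there x => simp only [Subst.lift, Val.rename_subst, Val.subst_rename]

mutual
theorem Val.subst_subst {S : Type u} {Γ Δ Θ : Ctx} {A : Ty} (θ : Subst S Γ Δ) (η : Subst S Δ Θ) :
    (v : Val S Γ A) → (v.subst θ).subst η = v.subst (fun B x => (θ B x).subst η)
  | .var x => by simp [Val.subst]
  | .zero => by simp [Val.subst]
  | .succ v => by simp [Val.subst, Val.subst_subst _ _ v]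
  | .star => by simp [Val.subst]
  | .lam t => by simp [Val.subst, Comp.subst_subst _ _ t, Subst.lift_subst]
theorem Comp.subst_subst {S : Type u} {Γ Δ Θ : Ctx} (θ : Subst S Γ Δ) (η : Subst S Δ Θ) :
    (t : Comp S Γ) → (t.subst θ).subst η = t.subst (fun B x => (θ B x).subst η)
  | .app v w => by
    simp [Comp.subst, Val.subst_subst _ _ v, fun i => Val.subst_subst θ η (w i)]
  | .mu v w => by
    simp [Comp.subst, Val.subst_subst _ _ v, fun i => Val.subst_subst θ η (w i),
      Subst.lift_subst]
  | .op σ v t => by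
    simp [Comp.subst, Val.subst_subst _ _ v, Comp.subst_subst _ _ t, Subst.lift_subst]
  | .halt => by simp [Comp.subst]
  | .caseNat v s t => by
    simp [Comp.subst, Val.subst_subst _ _ v, Comp.subst_subst _ _ s, Comp.subst_subst _ _ t,
      Subst.lift_subst]
end

theorem Subst.lift_var {S : Type u} {Γ : Ctx} {n : ℕ} {A : Fin n → Ty} :
    Subst.lift (A := A) (fun (B : Ty) (x : Var Γ B) => (Val.var x : Val S Γ B)) =
      fun _ x => Val.var x := by
  funext B x
  cases x with
  | here i => rfl
  | there x => simp [Subst.lift, Val.rename]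

mutual
theorem Val.subst_var {S : Type u} {Γ : Ctx} {A : Ty} :
    (v : Val S Γ A) → v.subst (fun _ x => Val.var x) = v
  | .var x => by simp [Val.subst]
  | .zero => by simp [Val.subst]
  | .succ v => by simp [Val.subst, Val.subst_var v]
  | .star => by simp [Val.subst]
  | .lam t => by simp [Val.subst, Comp.subst_var t, Subst.lift_var]
theorem Comp.subst_var {S : Type u} {Γ : Ctx} :
    (t : Comp S Γ) → t.subst (fun _ x => Val.var x) = t
  | .app v w => by simp [Comp.subst, Val.subst_var v, fun i => Val.subst_var (w i)]
  | .mu v w => by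
    simp [Comp.subst, Val.subst_var v, fun i => Val.subst_var (w i), Subst.lift_var]
  | .op σ v t => by simp [Comp.subst, Val.subst_var v, Comp.subst_var t, Subst.lift_var]
  | .halt => by simp [Comp.subst]
  | .caseNat v s t => by
    simp [Comp.subst, Val.subst_var v, Comp.subst_var s, Comp.subst_var t, Subst.lift_var]
end

/-- The substitution `θ, w₁/x₁, …, wₙ/xₙ`. -/
def Subst.cons {S : Type u} {Γ Δ : Ctx} {n : ℕ} {A : Fin n → Ty} (θ : Subst S Γ Δ)
    (w : ∀ i, Val S Δ (A i)) : Subst S (Γ.ext A) Δ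
  | _, Var.here i => w i
  | _, Var.there x => θ _ x

theorem Subst.lift_inst {S : Type u} {Γ Δ : Ctx} {n : ℕ} {A : Fin n → Ty} (θ : Subst S Γ Δ)
    (w : ∀ i, Val S Δ (A i)) :
    (fun B x => (θ.lift B x).subst (Subst.inst w)) = θ.cons w := by
  funext B x
  cases x with
  | here i => simp [Subst.lift, Val.subst, Subst.inst, Subst.cons]
  | there x => simp only [Subst.lift, Val.rename_subst, Subst.inst, Val.subst_var, Subst.cons]

theorem Comp.subst_lift_inst {S : Type u} {Γ Δ : Ctx} {n : ℕ} {A : Fin n → Ty}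
    (θ : Subst S Γ Δ) (w : ∀ i, Val S Δ (A i)) (t : Comp S (Γ.ext A)) :
    (t.subst θ.lift).subst (Subst.inst w) = t.subst (θ.cons w) := by
  rw [Comp.subst_subst, Subst.lift_inst]

theorem Val.subst_lift_inst {S : Type u} {Γ Δ : Ctx} {n : ℕ} {A : Fin n → Ty} {B : Ty}
    (θ : Subst S Γ Δ) (w : ∀ i, Val S Δ (A i)) (v : Val S (Γ.ext A) B) :
    (v.subst θ.lift).subst (Subst.inst w) = v.subst (θ.cons w) := by
  rw [Val.subst_subst, Subst.lift_inst]

/-- `λ(y₁,…,yₙ). (μ x. v)(y₁,…,yₙ)` applied to `w` reduces to `(μ x. v)(w)`. -/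
theorem next_app_unroll {S : Type u} {n : ℕ} {A : Fin n → Ty}
    (v : Val S (Ctx.nil.snoc (Ty.neg A)) (Ty.neg A)) (w : ∀ i, CVal S (A i)) :
    (Comp.app v.unroll w).next = .reduce (.mu v w) := by
  rw [Val.unroll, Comp.next, Comp.subst, Val.rename_subst, Subst.lift_comp_ren]
  simp only [Subst.inst, Val.subst]
  rw [Subst.lift_var, Val.subst_var]

/-! ## Closed values of base type -/

theorem CVal.eq_numeral {S : Type u} : (v : CVal S Ty.nat) → v = numeral v.toNat
  | .var x => nomatch x
  | .zero => by simp [Val.toNat, numeral]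
  | .succ v => by
    rw [Val.toNat, numeral, ← CVal.eq_numeral v]

/-! ## Trees and observations -/

theorem approx_le_tree {S : Type u} (n : ℕ) (t : CComp S) : approx n t ≤ tree t :=
  le_ωSup (⟨fun n => approx n t, monotone_nat_of_le_succ fun n => approx_le_succ n t⟩ :
    Chain (EffTree S)) n

theorem ScottOpen.tree_mem_iff {S : Type u} {P : Set (EffTree S)} (hP : ScottOpen P)
    (t : CComp S) : tree t ∈ P ↔ ∃ n, approx n t ∈ P :=
  ⟨fun h => hP.2 _ h, fun ⟨n, h⟩ => hP.1 (approx_le_tree n t) h⟩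

theorem ScottOpen.tree_mem_of_next {S : Type u} {P : Set (EffTree S)} (hP : ScottOpen P)
    {t s : CComp S} (h : t.next = .reduce s) (hs : tree s ∈ P) : tree t ∈ P := by
  obtain ⟨n, hn⟩ := (hP.tree_mem_iff s).1 hs
  refine (hP.tree_mem_iff t).2 ⟨n + 1, ?_⟩
  rwa [approx, h]

theorem node_tree_le {S : Type u} {t : CComp S} {σ : S} {m : ℕ} {k : ℕ → CComp S}
    (h : t.next = .effect σ m k) : EffTree.node σ m (fun i => tree (k i)) ≤ tree t := by
  have key : ∀ n, EffTree.node σ m (fun i => approx n (k i)) ≤ tree t := fun n => by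
    have := approx_le_tree (n + 1) t
    rwa [approx, h] at this
  intro p
  cases p with
  | nil => exact key 0 []
  | cons i q =>
    rcases EffTree.supLabel_cases ⟨fun n => approx n (k i),
      monotone_nat_of_le_succ fun n => approx_le_succ n (k i)⟩ q with h' | ⟨n, hn, h'⟩
    · exact Or.inl h'.1
    · exact Or.inr (h'.trans ((key n (i :: q)).resolve_left hn))

/-! ## A step-indexed logical relation -/

/-- Every observation made of the first `n` steps of `t` can be made of `s`. -/
def CRel {S : Type u} (𝔓 : Set (Set (EffTree S))) (n : ℕ) (t s : CComp S) : Prop :=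
  ∀ P ∈ 𝔓, ∀ m ≤ n, approx m t ∈ P → tree s ∈ P

/-- The step-indexed logical relation on closed values. -/
def VRel {S : Type u} (𝔓 : Set (Set (EffTree S))) : (A : Ty) → ℕ → CVal S A → CVal S A → Prop
  | .neg A, n, v, u => ∀ m ≤ n, ∀ w w' : ∀ i, CVal S (A i),
      (∀ i, VRel 𝔓 (A i) m (w i) (w' i)) → CRel 𝔓 m (.app v w) (.app u w')
  | .nat, _, v, u => v = u
  | .unit, _, _, _ => True

theorem CRel.mono {S : Type u} {𝔓 : Set (Set (EffTree S))} {n m : ℕ} {t s : CComp S}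
    (h : CRel 𝔓 n t s) (hm : m ≤ n) : CRel 𝔓 m t s :=
  fun P hP j hj => h P hP j (hj.trans hm)

theorem VRel.mono {S : Type u} {𝔓 : Set (Set (EffTree S))} {A : Ty} {n m : ℕ} {v u : CVal S A}
    (h : VRel 𝔓 A n v u) (hm : m ≤ n) : VRel 𝔓 A m v u := by
  cases A with
  | neg A =>
    rw [VRel] at h ⊢
    exact fun j hj => h j (hj.trans hm)
  | nat => exact h
  | unit => trivial

section Fundamental

variable {S : Type u} {𝔓 : Set (Set (EffTree S))}

theorem approx_zero_mem {P : Set (EffTree S)} (hP : ScottOpen P) {t : CComp S}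
    (h : approx 0 t ∈ P) (a : EffTree S) : a ∈ P := hP.1 (EffTree.bot_le a) h

theorem CRel.of_next (hopen : ∀ P ∈ 𝔓, ScottOpen P) {n : ℕ} {t t' s s' : CComp S}
    (ht : t.next = .reduce t') (hs : s.next = .reduce s')
    (h : ∀ m < n, CRel 𝔓 m t' s') : CRel 𝔓 n t s := by
  intro P hP m hm hmem
  cases m with
  | zero => exact approx_zero_mem (hopen P hP) hmem _
  | succ m =>
    rw [approx, ht] at hmem
    exact (hopen P hP).tree_mem_of_next hs (h m hm P hP m le_rfl hmem)

theorem CRel.of_effect (hdec : Decomposable 𝔓) (hopen : ∀ P ∈ 𝔓, ScottOpen P) {n : ℕ}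
    {t s : CComp S} {σ : S} {j : ℕ} {k l : ℕ → CComp S}
    (ht : t.next = .effect σ j k) (hs : s.next = .effect σ j l)
    (h : ∀ i, CRel 𝔓 n (k i) (l i)) : CRel 𝔓 n t s := by
  intro P hP m hm hmem
  cases m with
  | zero => exact approx_zero_mem (hopen P hP) hmem _
  | succ m =>
    rw [approx, ht] at hmem
    obtain ⟨Q, hQ, hk, hnode⟩ := hdec P hP _ hmem σ j _ rfl
    exact (hopen P hP).1 (node_tree_le hs)
      (hnode _ fun i => h i (Q i) (hQ i) m (Nat.le_of_succ_le hm) (hk i))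

/-- Closing substitutions related at index `n`. -/
def SRel (𝔓 : Set (Set (EffTree S))) (n : ℕ) {Γ : Ctx} (θ η : Subst S Γ Ctx.nil) : Prop :=
  ∀ A x, VRel 𝔓 A n (θ A x) (η A x)

theorem SRel.mono {n m : ℕ} {Γ : Ctx} {θ η : Subst S Γ Ctx.nil} (h : SRel 𝔓 n θ η)
    (hm : m ≤ n) : SRel 𝔓 m θ η :=
  fun A x => (h A x).mono hm

theorem SRel.cons {k n : ℕ} {Γ : Ctx} {A : Fin k → Ty} {θ η : Subst S Γ Ctx.nil}
    (h : SRel 𝔓 n θ η) {w w' : ∀ i, CVal S (A i)} (hw : ∀ i, VRel 𝔓 (A i) n (w i) (w' i)) :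
    SRel 𝔓 n (θ.cons w) (η.cons w') := by
  intro B x
  cases x with
  | here i => exact hw i
  | there x => exact h _ x

theorem CRel.mu (hopen : ∀ P ∈ 𝔓, ScottOpen P) {Γ : Ctx} {k : ℕ} {A : Fin k → Ty}
    (v : Val S (Γ.snoc (Ty.neg A)) (Ty.neg A))
    (hv : ∀ n (θ η : Subst S (Γ.snoc (Ty.neg A)) Ctx.nil), SRel 𝔓 n θ η →
      VRel 𝔓 (Ty.neg A) n (v.subst θ) (v.subst η)) (n : ℕ) :
    ∀ θ η : Subst S Γ Ctx.nil, SRel 𝔓 n θ η → ∀ w w' : ∀ i, CVal S (A i),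
      (∀ i, VRel 𝔓 (A i) n (w i) (w' i)) →
        CRel 𝔓 n (.mu (v.subst θ.lift) w) (.mu (v.subst η.lift) w') := by
  induction n using Nat.strong_induction_on with
  | _ n ih =>
    intro θ η h w w' hw
    refine CRel.of_next hopen (by rw [Comp.next]) (by rw [Comp.next]) fun m hm => ?_
    have hu : VRel 𝔓 (Ty.neg A) m (v.subst θ.lift).unroll (v.subst η.lift).unroll := by
      rw [VRel]
      intro j hj w w' hw
      exact CRel.of_next hopen (next_app_unroll _ _) (next_app_unroll _ _) fun i hi =>
        (ih j (hj.trans_lt hm) θ η (h.mono (hj.trans hm.le)) w w' hw).mono hi.le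
    have := hv m _ _ ((h.mono hm.le).cons (A := fun _ : Fin 1 => Ty.neg A) fun _ => hu)
    rw [Subst.inst₁, Subst.inst₁, Val.subst_lift_inst, Val.subst_lift_inst]
    rw [VRel] at this
    exact this m le_rfl w w' fun i => (hw i).mono hm.le

mutual
theorem Val.fundamental (hdec : Decomposable 𝔓) (hopen : ∀ P ∈ 𝔓, ScottOpen P)
    {Γ : Ctx} {A : Ty} : (v : Val S Γ A) → ∀ (n : ℕ) (θ η : Subst S Γ Ctx.nil),
      SRel 𝔓 n θ η → VRel 𝔓 A n (v.subst θ) (v.subst η)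
  | .var x => fun n θ η h => by
    rw [Val.subst, Val.subst]
    exact h _ x
  | .zero => fun n θ η h => by
    rw [VRel, Val.subst, Val.subst]
  | .succ v => fun n θ η h => by
    have := Val.fundamental hdec hopen v n θ η h
    rw [VRel] at this
    rw [VRel, Val.subst, Val.subst, this]
  | .star => fun n θ η h => by
    rw [VRel]
    trivial
  | .lam t => fun n θ η h => by
    rw [VRel]
    intro m hm w w' hw
    have := Comp.fundamental hdec hopen t m _ _ ((h.mono hm).cons hw)
    rw [Val.subst, Val.subst]
    refine CRel.of_next hopen (by rw [Comp.next]) (by rw [Comp.next]) fun j hj => ?_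
    rw [Comp.subst_lift_inst, Comp.subst_lift_inst]
    exact this.mono hj.le
theorem Comp.fundamental (hdec : Decomposable 𝔓) (hopen : ∀ P ∈ 𝔓, ScottOpen P)
    {Γ : Ctx} : (t : Comp S Γ) → ∀ (n : ℕ) (θ η : Subst S Γ Ctx.nil),
      SRel 𝔓 n θ η → CRel 𝔓 n (t.subst θ) (t.subst η)
  | .app v w => fun n θ η h => by
    have := Val.fundamental hdec hopen v n θ η h
    rw [VRel] at this
    rw [Comp.subst, Comp.subst]
    exact this n le_rfl _ _ fun i => Val.fundamental hdec hopen (w i) n θ η h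
  | .mu v w => fun n θ η h => by
    rw [Comp.subst, Comp.subst]
    exact CRel.mu hopen v (fun n θ η h => Val.fundamental hdec hopen v n θ η h) n θ η h _ _
      fun i => Val.fundamental hdec hopen (w i) n θ η h
  | .op σ v t => fun n θ η h => by
    have hv := Val.fundamental hdec hopen v n θ η h
    rw [VRel] at hv
    rw [Comp.subst, Comp.subst, hv]
    refine CRel.of_effect hdec hopen (by rw [Comp.next]) (by rw [Comp.next]) fun i => ?_
    rw [Subst.inst₁, Comp.subst_lift_inst, Comp.subst_lift_inst]
    exact Comp.fundamental hdec hopen t n _ _ (h.cons fun _ => by rw [VRel])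
  | .halt => fun n θ η h => by
    rw [Comp.subst, Comp.subst]
    exact fun P hP m _ hmem => (hopen P hP).1 (approx_le_tree m _) hmem
  | .caseNat v s t => fun n θ η h => by
    have hv := Val.fundamental hdec hopen v n θ η h
    rw [VRel] at hv
    have hs := Comp.fundamental hdec hopen s n θ η h
    have ht := Comp.fundamental hdec hopen t
    rw [Comp.subst, Comp.subst, hv]
    generalize v.subst η = u
    cases u with
    | var x => nomatch x
    | zero =>
      exact CRel.of_next hopen (by rw [Comp.next]) (by rw [Comp.next]) fun m hm => hs.mono hm.le
    | succ u =>
      refine CRel.of_next hopen (by rw [Comp.next]) (by rw [Comp.next]) fun m hm => ?_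
      rw [Subst.inst₁, Comp.subst_lift_inst, Comp.subst_lift_inst]
      exact ht m _ _ ((h.mono hm.le).cons fun _ => by rw [VRel])
end

theorem VRel.refl (hdec : Decomposable 𝔓) (hopen : ∀ P ∈ 𝔓, ScottOpen P) {A : Ty} (n : ℕ)
    (v : CVal S A) : VRel 𝔓 A n v v := by
  have := Val.fundamental hdec hopen v n (fun _ x => Val.var x) (fun _ x => Val.var x)
    (fun _ x => nomatch x)
  rwa [Val.subst_var] at this

/-- Applying a value to arguments that are related at all indices preserves observations. -/
theorem tree_app_mem_of_vRel (hdec : Decomposable 𝔓) (hopen : ∀ P ∈ 𝔓, ScottOpen P) {k : ℕ}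
    {A : Fin k → Ty} (v : CVal S (Ty.neg A)) {w u : ∀ i, CVal S (A i)}
    (h : ∀ i n, VRel 𝔓 (A i) n (w i) (u i)) {P : Set (EffTree S)} (hP : P ∈ 𝔓)
    (hw : tree (.app v w) ∈ P) : tree (.app v u) ∈ P := by
  obtain ⟨n, hn⟩ := ((hopen P hP).tree_mem_iff _).1 hw
  have := VRel.refl hdec hopen n v
  rw [VRel] at this
  exact this n le_rfl w u (fun i => h i n) P hP n le_rfl hn

/-- The logical preorder is contained in the logical relation at every index. -/
theorem FPreorder.vRel (hdec : Decomposable 𝔓) (hopen : ∀ P ∈ 𝔓, ScottOpen P) {L : Fragment}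
    (A : Ty) : ∀ (v u : CVal S A), FPreorder 𝔓 L v u → ∀ n, VRel 𝔓 A n v u := by
  induction A with
  | nat =>
    intro v u h n
    rw [VRel]
    have := h (.nat v.toNat)
    simp only [FFormula.Sat] at this
    rw [this v.eq_numeral]
    exact v.eq_numeral
  | unit => exact fun _ _ _ _ => trivial
  | neg A ih =>
    intro v u h n
    rw [VRel]
    intro m _ w w' hw P hP j hj hmem
    have hv := VRel.refl hdec hopen m v
    rw [VRel] at hv
    have hvw : tree (.app v w') ∈ P := hv m le_rfl w w' hw P hP j hj hmem
    have := h (.arrow (fun i => charFormula 𝔓 L (w' i)) ⟨P, hP⟩)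
    simp only [FFormula.Sat, sat_charFormula] at this
    exact this (fun w'' hw'' =>
      tree_app_mem_of_vRel hdec hopen v (fun i => ih i _ _ (hw'' i)) hP hvw) w' fun _ _ hφ => hφ

end Fundamental

theorem FFormula.sat_flat {S : Type u} {𝔓 : Set (Set (EffTree S))} {L : Fragment} {A : Ty}
    (φ : FFormula 𝔓 L A) (v : CVal S A) : φ.Sat v ↔ φ.flat.Sat v := by
  induction φ with
  | nat n => simp only [FFormula.flat, FFormula.Sat, VFormula.Sat]
  | arrow φ P ih => simp only [FFormula.flat, FFormula.Sat, VFormula.Sat, ih, Subtype.forall]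
  | disj φ ih => simp only [FFormula.flat, FFormula.Sat, VFormula.Sat, ih]
  | conj φ ih => simp only [FFormula.flat, FFormula.Sat, VFormula.Sat, ih]
  | neg h φ ih => simp only [FFormula.flat, FFormula.Sat, VFormula.Sat, ih]

theorem VFormula.sat_sharp {S : Type u} {𝔓 : Set (Set (EffTree S))} (hdec : Decomposable 𝔓)
    (hopen : ∀ P ∈ 𝔓, ScottOpen P) {L : Fragment} {A : Ty} (φ : VFormula 𝔓 L A) (v : CVal S A) :
    φ.Sat v ↔ φ.sharp.Sat v := by
  induction φ with
  | nat n => simp only [VFormula.sharp, FFormula.Sat, VFormula.Sat]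
  | arrow w P =>
    simp only [VFormula.sharp, FFormula.Sat, VFormula.Sat, sat_charFormula]
    exact ⟨fun h u hu => tree_app_mem_of_vRel hdec hopen v
      (fun i => FPreorder.vRel hdec hopen _ _ _ (hu i)) P.2 h, fun h => h w fun _ _ hφ => hφ⟩
  | disj φ ih => simp only [VFormula.sharp, FFormula.Sat, VFormula.Sat, ih]
  | conj φ ih => simp only [VFormula.sharp, FFormula.Sat, VFormula.Sat, ih]
  | neg h φ ih => simp only [VFormula.sharp, FFormula.Sat, VFormula.Sat, ih]

end ECPS

theorem mainTheorem6 {S : Type*} (𝔓 : Set (Set (EffTree S)))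
    (hdec : Decomposable 𝔓) (hopen : ∀ P ∈ 𝔓, ScottOpen P) (L : Fragment) :
    ((∀ (A : Ty) (φ : FFormula 𝔓 L A) (v : CVal S A), φ.Sat v ↔ φ.flat.Sat v) ∧
      (∀ (P : CompFormula 𝔓) (t : CComp S),
        CompFormula.Sat P t ↔ CompFormula.Sat (CompFormula.flat P) t)) ∧
    ((∀ (A : Ty) (φ : VFormula 𝔓 L A) (v : CVal S A), φ.Sat v ↔ φ.sharp.Sat v) ∧
      (∀ (P : CompFormula 𝔓) (t : CComp S),
        CompFormula.Sat P t ↔ CompFormula.Sat (CompFormula.sharp P) t)) :=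
  ⟨⟨fun _ φ v => φ.sat_flat v, fun _ _ => Iff.rfl⟩,
    ⟨fun _ φ v => φ.sat_sharp hdec hopen v, fun _ _ => Iff.rfl⟩⟩
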